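/- Let $A$ be a commutative, noetherian, reduced ring with identity, fix a term order on the set $\mathcal{T}$ of power products of $x=(x_1,\dots,x_n)$, and let $I\subset A[x]$ be an ideal. For $\mathfrak{p}\in\operatorname{Spec}(A)$ let $\sigma_{\mathfrak{p}}:A[x]\to k(\mathfrak{p})[x]$ be the coefficientwise extension of $A\to k(\mathfrak{p})$, let $\langle\sigma_{\mathfrak{p}}(I)\rangle$ be the ideal generated by $\sigma_{\mathfrak{p}}(I)$, and let $\operatorname{lt}(J)\subset\mathcal{T}$ denote the set of leading terms of the nonzero elements of an ideal $J$. For a locally closed $Y\subset\operatorname{Spec}(A)$ let $\mathfrak{a}\subset A$ be the radical ideal with $\overline{Y}=\operatorname{V}(\mathfrak{a})$, let $\overline{I}$ be the extension of $I$ in $(A/\mathfrak{a})[x]$, and let $\mathcal{I}_Y$ be the restriction to $Y$ of the quasi-coherent sheaf on $\operatorname{Spec}(A/\mathfrak{a})=\operatorname{V}(\mathfrak{a})$ associated with the $A/\mathfrak{a}$-module $\overline{I}$. Thus $\mathcal{I}_Y(Y)$ consists of the functions $g:Y\to\coprod_{\mathfrak{p}\in Y}\overline{I}_{\mathfrak{p}}$,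 $g(\mathfrak p)\in\overline I_{\mathfrak p}$, which are locally of the form $P/s$ with $P\in\overline{I}$, $s\in A/\mathfrak{a}$. For $g\in\mathcal{I}_Y(Y)$ let $\overline{g}^{\mathfrak{p}}$ be the image of $g(\mathfrak{p})$ in $\langle\sigma_{\mathfrak{p}}(I)\rangle\subset k(\mathfrak{p})[x]$. A finite set $G\subset\mathcal{I}_Y(Y)$ is called a reduced Gröbner basis of $I$ over $Y$ if $\{\overline{g}^{\mathfrak{p}} : g\in G\}$ is the reduced Gröbner basis of $\langle\sigma_{\mathfrak{p}}(I)\rangle$ for every $\mathfrak{p}\in Y$ and, for each $g\in G$, the function $\mathfrak{p}\mapsto\operatorname{lt}(\overline{g}^{\mathfrak{p}})$ is constant on $Y$. The set $Y$ is called parametric with respect to $I$ if it is locally closed and such a $G$ exists. A Gröbner cover of a locally closed set $L\subset\operatorname{Spec}(A)$ is a finite set of pairs $(Y,G_Y)$, with $Y$ parametric and $G_Y$ a reduced Gröbner basis of $I$ over $Y$, such that $L$ is the union of the sets $Y$. Theorem. Let $I\subset A[x]$ be a homogeneous ideal (with respect to total degree in $x$) and let $L\subset\operatorname{Spec}(A)$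 be locally closed. Then the equivalence classes of the equivalence relation on $L$ defined by $\mathfrak{p}\sim\mathfrak{p}'$ if $\operatorname{lt}(\langle\sigma_{\mathfrak{p}}(I)\rangle)=\operatorname{lt}(\langle\sigma_{\mathfrak{p}'}(I)\rangle)$ are parametric with respect to $I$; in particular they are locally closed. Moreover there is exactly one Gröbner cover of $L$ with respect to $I$ whose sets $Y$ are exactly these equivalence classes (the canonical Gröbner cover of $L$). -/

import Mathlib

/-!
Families of Groebner bases over the spectrum of a noetherian ring `A`.

Terms in `x_1, ..., x_n` are exponent vectors `Fin n →₀ ℕ`, so that divisibility of terms is the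
pointwise order `≤`; a term order is a `MonomialOrder (Fin n)`; `m.degree P` is the leading term
(a power product) of `P`, and `m.leadingTerm P` is the leading coefficient times the leading term.
-/

namespace GroebnerCover

open MvPolynomial

noncomputable section

/-! ### Leading terms and reduced Groebner bases -/

/-- The set `lt(F)` of leading terms (exponent vectors) of the nonzero elements of `F`. -/
def ltSet {n : ℕ} {R : Type*} [CommRing R] (m : MonomialOrder (Fin n))
    (F : Set (MvPolynomial (Fin n) R)) : Set (Fin n →₀ ℕ) :=
  {t | ∃ P ∈ F, P ≠ 0 ∧ m.degree P = t}

/-- `G` is a Groebner basis of the ideal `J`: a finite subset of `J` such that the leading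
coefficient-times-term monomials of `G` and of `J` generate the same ideal. -/
def IsGroebnerBasis {n : ℕ} {R : Type*} [CommRing R] (m : MonomialOrder (Fin n))
    (J : Ideal (MvPolynomial (Fin n) R)) (G : Set (MvPolynomial (Fin n) R)) : Prop :=
  G.Finite ∧ G ⊆ (J : Set (MvPolynomial (Fin n) R)) ∧
    Ideal.span (m.leadingTerm '' G) =
      Ideal.span (m.leadingTerm '' (J : Set (MvPolynomial (Fin n) R)))

/-- `G` is the reduced Groebner basis of `J`: a Groebner basis with monic elements such that no
term in the support of an element is divisible by the leading term of another element. -/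
def IsReducedGroebnerBasis {n : ℕ} {R : Type*} [CommRing R] (m : MonomialOrder (Fin n))
    (J : Ideal (MvPolynomial (Fin n) R)) (G : Set (MvPolynomial (Fin n) R)) : Prop :=
  IsGroebnerBasis m J G ∧
    ∀ g ∈ G, m.Monic g ∧ ∀ h ∈ G, h ≠ g → ∀ t ∈ g.support, ¬ m.degree h ≤ t

/-! ### Fibres -/

section

variable {n : ℕ} {A : Type*} [CommRing A]

/-- The ideal `⟨σ_p(I)⟩` of `k(p)[x]`, where `σ_p : A[x] → k(p)[x]` is the coefficientwise
extension of `A → k(p)`. -/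
def fibreIdeal (I : Ideal (MvPolynomial (Fin n) A)) (p : PrimeSpectrum A) :
    Ideal (MvPolynomial (Fin n) p.asIdeal.ResidueField) :=
  I.map (MvPolynomial.map (algebraMap A p.asIdeal.ResidueField))

/-! ### The sheaf `I_Y` and its global sections

The radical ideal `a` of `A` with `closure Y = V(a)` is `PrimeSpectrum.vanishingIdeal Y`. -/

/-- The extension of `I` in `(A/a)[x]`, where `a` is the radical ideal with `closure Y = V(a)`. -/
def extIdeal (I : Ideal (MvPolynomial (Fin n) A)) (Y : Set (PrimeSpectrum A)) :
    Ideal (MvPolynomial (Fin n) (A ⧸ PrimeSpectrum.vanishingIdeal Y)) :=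
  I.map (MvPolynomial.map (Ideal.Quotient.mk (PrimeSpectrum.vanishingIdeal Y)))

/-- `extIdeal I Y` as an `A`-module. -/
abbrev extModule (I : Ideal (MvPolynomial (Fin n) A)) (Y : Set (PrimeSpectrum A)) :
    Submodule A (MvPolynomial (Fin n) (A ⧸ PrimeSpectrum.vanishingIdeal Y)) :=
  (extIdeal I Y).restrictScalars A

/-- The stalk at `p` of the sheaf `I_Y`, i.e. the localization at `p` of the `A/a`-module
`extIdeal I Y`. Since `(A/a) ∖ (p/a)` is the image of `A ∖ p`, this is the localization of the
same module, seen as an `A`-module, at `A ∖ p`. -/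
abbrev Stalk (I : Ideal (MvPolynomial (Fin n) A)) (Y : Set (PrimeSpectrum A))
    (p : PrimeSpectrum A) : Type _ :=
  LocalizedModule p.asIdeal.primeCompl (extModule I Y)

/-- The set `I_Y(Y)` of global sections of `I_Y`: functions from `Y` to the stalks that are locally
given by a fraction `P / s`. A set `U : Set Y` is open if it is open in the subspace topology. -/
def Sections (I : Ideal (MvPolynomial (Fin n) A)) (Y : Set (PrimeSpectrum A)) :
    Set ((p : Y) → Stalk I Y p.1) :=
  {g | ∀ p : Y, ∃ U : Set Y, IsOpen U ∧ p ∈ U ∧ ∃ (P : extModule I Y) (s : A),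
    ∀ q ∈ U, ∃ hs : s ∈ q.1.asIdeal.primeCompl, g q = LocalizedModule.mk P ⟨s, hs⟩}

/-- For `p ∈ Y`, the natural map `A/a → k(p)`. -/
def toResidue {Y : Set (PrimeSpectrum A)} (p : Y) :
    (A ⧸ PrimeSpectrum.vanishingIdeal Y) →ₐ[A] p.1.asIdeal.ResidueField :=
  Ideal.Quotient.liftₐ _ (Algebra.ofId A p.1.asIdeal.ResidueField) fun a ha =>
    Ideal.algebraMap_residueField_eq_zero.mpr
      ((PrimeSpectrum.mem_vanishingIdeal Y a).mp ha p.1 p.2)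

/-- The natural map from `extIdeal I Y ⊆ (A/a)[x]` to `k(p)[x]`. -/
def extModuleToFibre (I : Ideal (MvPolynomial (Fin n) A)) {Y : Set (PrimeSpectrum A)} (p : Y) :
    extModule I Y →ₗ[A] MvPolynomial (Fin n) p.1.asIdeal.ResidueField :=
  (MvPolynomial.mapAlgHom (toResidue p)).toLinearMap ∘ₗ (extModule I Y).subtype

theorem isUnit_algebraMap_end (p : PrimeSpectrum A) (s : p.asIdeal.primeCompl) :
    IsUnit (algebraMap A (Module.End A (MvPolynomial (Fin n) p.asIdeal.ResidueField)) s) := by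
  have hs : IsUnit (algebraMap A (MvPolynomial (Fin n) p.asIdeal.ResidueField) s) := by
    rw [MvPolynomial.algebraMap_apply]
    exact (IsUnit.mk0 _ fun h => s.2 (Ideal.algebraMap_residueField_eq_zero.mp h)).map
      (MvPolynomial.C (σ := Fin n))
  have h := hs.map (Algebra.lmul A (MvPolynomial (Fin n) p.asIdeal.ResidueField))
  rwa [AlgHom.commutes] at h

/-- The natural map from the stalk of `I_Y` at `p` to `k(p)[x]`, sending `P / s` to the image of
`P` divided by the image of `s`. -/
def stalkToFibre (I : Ideal (MvPolynomial (Fin n) A)) {Y : Set (PrimeSpectrum A)} (p : Y) :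
    Stalk I Y p.1 →ₗ[A] MvPolynomial (Fin n) p.1.asIdeal.ResidueField :=
  LocalizedModule.lift _ (extModuleToFibre I p) (isUnit_algebraMap_end p.1)

/-- The image of a global section `g` of `I_Y` in `⟨σ_p(I)⟩ ⊆ k(p)[x]`, for `p ∈ Y`. -/
def specialize {I : Ideal (MvPolynomial (Fin n) A)} {Y : Set (PrimeSpectrum A)} (p : Y)
    (g : Sections I Y) : MvPolynomial (Fin n) p.1.asIdeal.ResidueField :=
  stalkToFibre I p (g.1 p)

/-! ### Parametric sets and Groebner covers -/

/-- `G` is the reduced Groebner basis of `I` over `Y`: a finite set of global sections of `I_Y`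
that specializes to the reduced Groebner basis of `⟨σ_p(I)⟩` for every `p ∈ Y`, the leading term
of the specialization of each `g ∈ G` being constant on `Y`. -/
def IsReducedGroebnerBasisOver (m : MonomialOrder (Fin n)) (I : Ideal (MvPolynomial (Fin n) A))
    (Y : Set (PrimeSpectrum A)) (G : Set (Sections I Y)) : Prop :=
  G.Finite ∧
    (∀ p : Y, IsReducedGroebnerBasis m (fibreIdeal I p.1) (specialize p '' G)) ∧
    ∀ g ∈ G, ∀ p q : Y, m.degree (specialize p g) = m.degree (specialize q g)

/-- `Y` is parametric for Groebner bases with respect to `I` and the term order `m`. -/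
def IsParametric (m : MonomialOrder (Fin n)) (I : Ideal (MvPolynomial (Fin n) A))
    (Y : Set (PrimeSpectrum A)) : Prop :=
  IsLocallyClosed Y ∧ ∃ G : Set (Sections I Y), IsReducedGroebnerBasisOver m I Y G

/-- The equivalence classes of the relation `lt(⟨σ_p(I)⟩) = lt(⟨σ_q(I)⟩)` on `L`. -/
def ltClasses (m : MonomialOrder (Fin n)) (I : Ideal (MvPolynomial (Fin n) A))
    (L : Set (PrimeSpectrum A)) : Set (Set (PrimeSpectrum A)) :=
  {Y | ∃ p ∈ L, Y = {q | q ∈ L ∧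
    ltSet m (fibreIdeal I p : Set (MvPolynomial (Fin n) p.asIdeal.ResidueField)) =
      ltSet m (fibreIdeal I q : Set (MvPolynomial (Fin n) q.asIdeal.ResidueField))}}

/-- A Groebner cover of `L` with respect to `I` and `m`: a finite set of pairs `(Y, G)` with `Y`
parametric, `G` the reduced Groebner basis of `I` over `Y`, and `L` the union of the sets `Y`. -/
def IsGroebnerCover (m : MonomialOrder (Fin n)) (I : Ideal (MvPolynomial (Fin n) A))
    (L : Set (PrimeSpectrum A))
    (𝒢 : Set ((Y : Set (PrimeSpectrum A)) × Set (Sections I Y))) : Prop :=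
  𝒢.Finite ∧
    (∀ z ∈ 𝒢, IsParametric m I z.1 ∧ IsReducedGroebnerBasisOver m I z.1 z.2) ∧
    ⋃ z ∈ 𝒢, z.1 = L

end

end

end GroebnerCover

attribute [local instance] MvPolynomial.gradedAlgebra

namespace GroebnerCover

open MvPolynomial

noncomputable section
/-! ### Reduced Groebner bases over a field -/

section Field

variable {n : ℕ} {K : Type*} [Field K] (m : MonomialOrder (Fin n))
  (J : Ideal (MvPolynomial (Fin n) K))

/-! Over a field, an element of `J` is determined by its coefficients at the terms of `lt(J)`. So
each `t` in `lt(J)` has exactly one normal element, and the reduced Gröbner basis consists of the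
normal elements of the minimal terms (`isReducedGroebnerBasis_iff`). The task is to spread normal
elements over families of primes.

Write `T(p)` for the leading terms at `p` and `T_d(p)` for those of degree `d`. Homogeneity makes
each degree a problem of finite linear algebra: Cramer's rule lifts the normal elements at `p` to
`Q_t` in `I` whose coefficient matrix at `T_d(p)` is exactly `D` times the identity, with `D ∉ p`
(`exists_lift_normal`). Everything else rests on these lifts.

Independence of the `Q_t` bounds `|T_d|` under specialization, while leading terms at `p` persist on
an open part of its closure. Hence `T` is generically constant on irreducible closed sets, and
noetherian induction leaves finitely many values. In one degree the lifts show that `T_d = S` is a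
locally closed condition (`fibreTermsOfDegree_eq_of_mem_closure`). Finitely many degrees separate
the values of `T`, so the classes are locally closed.

On a class, the fractions `Q_t / D` specialize to normal elements. Since normal elements are unique
and sections are determined by their specializations, the fractions glue to sections. The same two
facts make the reduced basis over a nonempty class unique. -/

/-- The elements of `J` whose only term in `lt(J)` is `t`, with coefficient `1`. -/
def IsNormalElement (t : Fin n →₀ ℕ) (f : MvPolynomial (Fin n) K) : Prop :=
  f ∈ J ∧ ∀ u ∈ ltSet m (J : Set (MvPolynomial (Fin n) K)), coeff u f = if u = t then 1 else 0

variable {m J}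

theorem degree_mem_ltSet {f : MvPolynomial (Fin n) K} (hf : f ∈ J) (h0 : f ≠ 0) :
    m.degree f ∈ ltSet m (J : Set (MvPolynomial (Fin n) K)) :=
  ⟨f, hf, h0, rfl⟩

theorem eq_zero_of_coeff_ltSet {f : MvPolynomial (Fin n) K} (hf : f ∈ J)
    (h : ∀ u ∈ ltSet m (J : Set (MvPolynomial (Fin n) K)), coeff u f = 0) : f = 0 := by
  by_contra h0
  exact m.coeff_degree_ne_zero_iff.mpr h0 (h _ (degree_mem_ltSet hf h0))

theorem eq_of_coeff_ltSet {f g : MvPolynomial (Fin n) K} (hf : f ∈ J) (hg : g ∈ J)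
    (h : ∀ u ∈ ltSet m (J : Set (MvPolynomial (Fin n) K)), coeff u f = coeff u g) : f = g :=
  sub_eq_zero.mp <| eq_zero_of_coeff_ltSet (m := m) (J.sub_mem hf hg) fun u hu => by
    rw [coeff_sub, h u hu, sub_self]

theorem IsNormalElement.unique {t : Fin n →₀ ℕ} {f g : MvPolynomial (Fin n) K}
    (hf : IsNormalElement m J t f) (hg : IsNormalElement m J t g) : f = g :=
  eq_of_coeff_ltSet hf.1 hg.1 fun u hu => (hf.2 u hu).trans (hg.2 u hu).symm

theorem ltSet_isUpperSet : IsUpperSet (ltSet m (J : Set (MvPolynomial (Fin n) K))) := by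
  rintro t u htu ⟨f, hf, h0, rfl⟩
  have h1 : (monomial (u - m.degree f) (1 : K)) ≠ 0 := by simp
  refine ⟨monomial (u - m.degree f) 1 * f, J.mul_mem_left _ hf, mul_ne_zero h1 h0, ?_⟩
  classical
  rw [m.degree_mul h1 h0, m.degree_monomial, if_neg one_ne_zero, tsub_add_cancel_of_le htu]

/-- Full reduction by well-founded induction along the term order: from an `f` with leading term
`t`, subtract multiples of the normal elements of the smaller terms of `f` in `lt(J)`, then make it
monic. Subtracting one of them does not disturb the coefficient at any other term of `lt(J)`. -/
theorem exists_isNormalElement {t : Fin n →₀ ℕ}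
    (ht : t ∈ ltSet m (J : Set (MvPolynomial (Fin n) K))) : ∃ f, IsNormalElement m J t f := by
  classical
  induction h : m.toSyn t using WellFoundedLT.induction generalizing t with
  | ind a ih =>
    subst h
    obtain ⟨f, hf, h0, rfl⟩ := id ht
    set T := ltSet m (J : Set (MvPolynomial (Fin n) K))
    -- The conditions sit inside the existential, with default value 0, so that `choose` yields a
    -- function on all terms.
    have key : ∀ u : Fin n →₀ ℕ, ∃ g, u ∈ T → m.toSyn u < m.toSyn (m.degree f) →
        IsNormalElement m J u g := by
      intro u
      by_cases hu : u ∈ T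
      · by_cases hlt : m.toSyn u < m.toSyn (m.degree f)
        · obtain ⟨g, hg⟩ := ih _ hlt hu rfl
          exact ⟨g, fun _ _ => hg⟩
        · exact ⟨0, fun _ h => absurd h hlt⟩
      · exact ⟨0, fun h => absurd h hu⟩
    choose g hg using key
    have hlc := m.leadingCoeff_ne_zero_iff.mpr h0
    set S := f.support.filter fun u => u ∈ T ∧ u ≠ m.degree f with hS
    have hSg : ∀ u ∈ S, IsNormalElement m J u (g u) := by
      intro u hu
      rw [hS, Finset.mem_filter] at hu
      refine hg u hu.2.1 (lt_of_le_of_ne (m.le_degree hu.1) fun h => hu.2.2 (m.toSyn.injective h))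
    refine ⟨C (m.leadingCoeff f)⁻¹ * (f - ∑ u ∈ S, C (coeff u f) * g u),
      J.mul_mem_left _ (J.sub_mem hf (J.sum_mem fun u hu => J.mul_mem_left _ (hSg u hu).1)), ?_⟩
    intro u hu
    rw [coeff_C_mul, coeff_sub, coeff_sum]
    have : ∑ v ∈ S, coeff u (C (coeff v f) * g v) = if u ∈ S then coeff u f else 0 := by
      rw [← Finset.sum_ite_eq S u fun v => coeff v f]
      refine Finset.sum_congr rfl fun v hv => ?_
      rw [coeff_C_mul, (hSg v hv).2 u hu]
      split_ifs <;> simp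
    rw [this]
    by_cases hut : u = m.degree f
    · have : u ∉ S := by simp [hS, hut]
      rw [if_neg this, if_pos hut, hut, sub_zero]
      exact inv_mul_cancel₀ hlc
    · rw [if_neg hut]
      by_cases hus : u ∈ S
      · rw [if_pos hus]; simp
      · rw [if_neg hus]
        have : coeff u f = 0 := by
          by_contra h
          exact hus (Finset.mem_filter.mpr ⟨mem_support_iff.mpr h, hu, hut⟩)
        simp [this]

theorem IsNormalElement.ne_zero {t : Fin n →₀ ℕ} {f : MvPolynomial (Fin n) K}
    (ht : t ∈ ltSet m (J : Set (MvPolynomial (Fin n) K))) (hf : IsNormalElement m J t f) :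
    f ≠ 0 := by
  rintro rfl
  simpa using hf.2 t ht

theorem IsNormalElement.degree_eq {t : Fin n →₀ ℕ} {f : MvPolynomial (Fin n) K}
    (ht : t ∈ ltSet m (J : Set (MvPolynomial (Fin n) K))) (hf : IsNormalElement m J t f) :
    m.degree f = t := by
  by_contra h
  have h0 := hf.ne_zero ht
  have := hf.2 _ (degree_mem_ltSet hf.1 h0)
  rw [if_neg h] at this
  exact m.coeff_degree_ne_zero_iff.mpr h0 this

theorem IsNormalElement.monic {t : Fin n →₀ ℕ} {f : MvPolynomial (Fin n) K}
    (ht : t ∈ ltSet m (J : Set (MvPolynomial (Fin n) K))) (hf : IsNormalElement m J t f) :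
    m.Monic f := by
  have := hf.2 t ht
  rw [if_pos rfl] at this
  rwa [MonomialOrder.Monic, MonomialOrder.leadingCoeff, hf.degree_eq ht]

/-- Dickson's lemma: exponent vectors are well-quasi-ordered, and minimal elements form an
antichain. -/
theorem finite_minimal_terms (T : Set (Fin n →₀ ℕ)) : {t | Minimal (· ∈ T) t}.Finite :=
  WellQuasiOrderedLE.finite_of_isAntichain (setOfPred_minimal_antichain _)

theorem exists_minimal_term_le {T : Set (Fin n →₀ ℕ)} {u : Fin n →₀ ℕ} (hu : u ∈ T) :
    ∃ t ≤ u, Minimal (· ∈ T) t :=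
  exists_minimal_le_of_wellFoundedLT _ u hu

theorem leadingTerm_image_of_monic {R : Type*} [CommRing R] {G : Set (MvPolynomial (Fin n) R)}
    (hG : ∀ g ∈ G, m.Monic g) :
    m.leadingTerm '' G = (fun s => monomial s (1 : R)) '' (m.degree '' G) := by
  rw [Set.image_image]
  refine Set.image_congr fun g hg => ?_
  rw [MonomialOrder.leadingTerm, (hG g hg).leadingCoeff_eq_one]

theorem span_leadingTerm_ideal :
    Ideal.span (m.leadingTerm '' (J : Set (MvPolynomial (Fin n) K))) =
      Ideal.span ((fun s => monomial s (1 : K)) ''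
        ltSet m (J : Set (MvPolynomial (Fin n) K))) := by
  apply le_antisymm <;> rw [Ideal.span_le]
  · rintro _ ⟨f, hf, rfl⟩
    by_cases h0 : f = 0
    · simp [h0]
    · rw [MonomialOrder.leadingTerm, ← mul_one (m.leadingCoeff f), ← C_mul_monomial]
      exact Ideal.mul_mem_left _ _ (Ideal.subset_span ⟨_, degree_mem_ltSet hf h0, rfl⟩)
  · rintro _ ⟨t, ht, rfl⟩
    obtain ⟨f, hf⟩ := exists_isNormalElement ht
    refine Ideal.subset_span ⟨f, hf.1, ?_⟩
    rw [MonomialOrder.leadingTerm, hf.monic ht, hf.degree_eq ht]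

/-- The reduced Groebner basis consists of the normal elements of the minimal terms of `lt(J)`. -/
theorem isReducedGroebnerBasis_iff {G : Set (MvPolynomial (Fin n) K)} :
    IsReducedGroebnerBasis m J G ↔
      G = {f | ∃ t, Minimal (· ∈ ltSet m (J : Set (MvPolynomial (Fin n) K))) t ∧
        IsNormalElement m J t f} := by
  constructor
  · rintro ⟨⟨-, hGJ, hspan⟩, hred⟩
    have hmem : ∀ g ∈ G, m.degree g ∈ ltSet m (J : Set (MvPolynomial (Fin n) K)) := fun g hg =>
      degree_mem_ltSet (hGJ hg) (hred g hg).1.ne_zero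
    -- Membership in a monomial ideal is divisibility by a generator. With reducedness, this forces
    -- the degrees in `G` to be minimal and all other terms of its elements to lie outside `lt(J)`.
    have hdiv : ∀ u ∈ ltSet m (J : Set (MvPolynomial (Fin n) K)), ∃ h ∈ G, m.degree h ≤ u := by
      intro u hu
      rw [leadingTerm_image_of_monic fun g hg => (hred g hg).1, span_leadingTerm_ideal] at hspan
      have : monomial u (1 : K) ∈ Ideal.span ((fun s => monomial s (1 : K)) ''
        ltSet m (J : Set (MvPolynomial (Fin n) K))) := Ideal.subset_span ⟨u, hu, rfl⟩
      rw [← hspan, mem_ideal_span_monomial_image] at this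
      obtain ⟨_, ⟨h, hh, rfl⟩, hle⟩ := this u (by simp)
      exact ⟨h, hh, hle⟩
    have hmin : ∀ g ∈ G, Minimal (· ∈ ltSet m (J : Set (MvPolynomial (Fin n) K))) (m.degree g) := by
      refine fun g hg => ⟨hmem g hg, fun u hu hle => ?_⟩
      obtain ⟨h, hh, hhu⟩ := hdiv u hu
      by_cases hgh : h = g
      · rwa [← hgh]
      · exact absurd (hhu.trans hle)
          ((hred g hg).2 h hh hgh _ (m.degree_mem_support (hred g hg).1.ne_zero))
    have hnormal : ∀ g ∈ G, IsNormalElement m J (m.degree g) g := by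
      refine fun g hg => ⟨hGJ hg, fun u hu => ?_⟩
      split_ifs with h
      · rw [h]; exact (hred g hg).1.coeff_degree
      · by_contra h0
        obtain ⟨k, hk, hku⟩ := hdiv u hu
        have hus := mem_support_iff.mpr h0
        by_cases hgk : k = g
        · subst hgk
          exact h (m.toSyn.injective (le_antisymm (m.le_degree hus) (m.toSyn_monotone hku)))
        · exact (hred g hg).2 k hk hgk u hus hku
    ext f
    constructor
    · exact fun hf => ⟨_, hmin f hf, hnormal f hf⟩
    · rintro ⟨t, ht, hf⟩
      obtain ⟨g, hg, hle⟩ := hdiv t ht.1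
      have : m.degree g = t := le_antisymm hle (ht.2 (hmem g hg) hle)
      have hgn := hnormal g hg
      rw [this] at hgn
      rwa [hf.unique hgn]
  · rintro rfl
    have hmon : ∀ f ∈ {f | ∃ t, Minimal (· ∈ ltSet m (J : Set (MvPolynomial (Fin n) K))) t ∧
        IsNormalElement m J t f}, m.Monic f := by
      rintro f ⟨t, ht, hf⟩
      exact hf.monic ht.1
    refine ⟨⟨?_, ?_, ?_⟩, fun f hf => ⟨hmon f hf, ?_⟩⟩
    · refine Set.Finite.of_finite_image (f := m.degree)
        ((finite_minimal_terms (ltSet m (J : Set (MvPolynomial (Fin n) K)))).subset ?_) ?_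
      · rintro _ ⟨f, ⟨t, ht, hf⟩, rfl⟩
        rwa [hf.degree_eq ht.1]
      · rintro f ⟨t, ht, hf⟩ g ⟨u, hu, hg⟩ hfg
        rw [hf.degree_eq ht.1, hg.degree_eq hu.1] at hfg
        subst hfg
        exact hf.unique hg
    · rintro f ⟨t, ht, hf⟩
      exact hf.1
    · apply le_antisymm
      · refine Ideal.span_mono (Set.image_mono ?_)
        rintro f ⟨t, ht, hf⟩
        exact hf.1
      · rw [leadingTerm_image_of_monic hmon, span_leadingTerm_ideal, Ideal.span_le]
        rintro _ ⟨u, hu, rfl⟩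
        obtain ⟨t, htu, ht⟩ := exists_minimal_term_le hu
        obtain ⟨f, hf⟩ := exists_isNormalElement ht.1
        refine mem_ideal_span_monomial_image.mpr fun v hv => ?_
        obtain rfl : v = u := by
          classical
          by_contra h
          rw [mem_support_iff, coeff_monomial, if_neg (Ne.symm h)] at hv
          exact hv rfl
        exact ⟨t, ⟨f, ⟨t, ht, hf⟩, hf.degree_eq ht.1⟩, htu⟩
    · obtain ⟨t, ht, hft⟩ := hf
      rintro g ⟨u, hu, hgu⟩ hne v hv hle
      rw [hgu.degree_eq hu.1] at hle
      have hvT := ltSet_isUpperSet hle hu.1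
      have hvt : v = t := by
        by_contra h
        exact mem_support_iff.mp hv (by rw [hft.2 v hvT, if_neg h])
      have : u = t := by
        subst hvt
        exact le_antisymm hle (ht.2 hu.1 hle)
      subst this
      exact hne (hgu.unique hft)

end Field

/-! ### Leading terms of the fibres -/

section Fibres

variable {n : ℕ} {A : Type*} [CommRing A] (m : MonomialOrder (Fin n))
  (I : Ideal (MvPolynomial (Fin n) A))

/-- The set `lt(⟨σ_p(I)⟩)`. -/
def fibreTerms (p : PrimeSpectrum A) : Set (Fin n →₀ ℕ) :=
  ltSet m (fibreIdeal I p : Set (MvPolynomial (Fin n) p.asIdeal.ResidueField))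

/-- The terms of total degree `d` in `lt(⟨σ_p(I)⟩)`. -/
def fibreTermsOfDegree (d : ℕ) (p : PrimeSpectrum A) : Set (Fin n →₀ ℕ) :=
  {t | t ∈ fibreTerms m I p ∧ t.degree = d}

/-- The coefficientwise extension `A[x] → k(p)[x]` of `A → k(p)`. -/
abbrev toFibre (p : PrimeSpectrum A) :
    MvPolynomial (Fin n) A →+* MvPolynomial (Fin n) p.asIdeal.ResidueField :=
  MvPolynomial.map (algebraMap A p.asIdeal.ResidueField)

variable {m I}

theorem finite_fibreTermsOfDegree (d : ℕ) (p : PrimeSpectrum A) :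
    (fibreTermsOfDegree m I d p).Finite :=
  (Finsupp.finite_of_degree_eq d).subset fun _ h => h.2

theorem algebraMap_residueField_eq_zero_iff {p : PrimeSpectrum A} {a : A} :
    algebraMap A p.asIdeal.ResidueField a = 0 ↔ a ∈ p.asIdeal :=
  Ideal.algebraMap_residueField_eq_zero

theorem toFibre_mem {P : MvPolynomial (Fin n) A} (hP : P ∈ I) (p : PrimeSpectrum A) :
    toFibre p P ∈ fibreIdeal I p :=
  Ideal.mem_map_of_mem _ hP

theorem map_homogeneousComponent {R S : Type*} [CommSemiring R] [CommSemiring S] (φ : R →+* S)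
    (d : ℕ) (P : MvPolynomial (Fin n) R) :
    MvPolynomial.map φ (homogeneousComponent d P) =
      homogeneousComponent d (MvPolynomial.map φ P) := by
  ext u
  rw [coeff_map, coeff_homogeneousComponent, coeff_homogeneousComponent, coeff_map]
  split_ifs <;> simp

/-! ### Clearing denominators: lifting fibre elements to `A[x]` and to `I` -/

theorem exists_algebraMap_eq_mul (p : PrimeSpectrum A) (a : p.asIdeal.ResidueField) :
    ∃ b s : A, s ∉ p.asIdeal ∧ algebraMap A _ b = algebraMap A _ s * a := by
  obtain ⟨x, y, hy, rfl⟩ := IsFractionRing.div_surjective (A := A ⧸ p.asIdeal) a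
  obtain ⟨b, rfl⟩ := Ideal.Quotient.mk_surjective x
  obtain ⟨s, rfl⟩ := Ideal.Quotient.mk_surjective y
  have hs : s ∉ p.asIdeal := fun h =>
    nonZeroDivisors.ne_zero hy (Ideal.Quotient.eq_zero_iff_mem.mpr h)
  refine ⟨b, s, hs, ?_⟩
  have h0 : algebraMap A p.asIdeal.ResidueField s ≠ 0 :=
    fun h => hs (algebraMap_residueField_eq_zero_iff.mp h)
  have e (x : A) : algebraMap (A ⧸ p.asIdeal) p.asIdeal.ResidueField (Ideal.Quotient.mk _ x) =
    algebraMap A _ x := (IsScalarTower.algebraMap_apply A (A ⧸ p.asIdeal) _ x).symm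
  rw [e, e, mul_div_cancel₀ _ h0]

theorem exists_toFibre_eq_C_mul (p : PrimeSpectrum A)
    (f : MvPolynomial (Fin n) p.asIdeal.ResidueField) :
    ∃ P, ∃ s : A, s ∉ p.asIdeal ∧ toFibre p P = C (algebraMap A _ s) * f := by
  induction f using MvPolynomial.induction_on with
  | C a =>
    obtain ⟨b, s, hs, h⟩ := exists_algebraMap_eq_mul p a
    exact ⟨C b, s, hs, by rw [map_C, h, C_mul]⟩
  | add f g hf hg =>
    obtain ⟨P, s, hs, hP⟩ := hf
    obtain ⟨Q, t, ht, hQ⟩ := hg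
    refine ⟨C t * P + C s * Q, s * t, p.asIdeal.primeCompl.mul_mem hs ht, ?_⟩
    simp only [map_add, map_mul, map_C, hP, hQ]
    ring
  | mul_X f i hf =>
    obtain ⟨P, s, hs, hP⟩ := hf
    exact ⟨P * X i, s, hs, by rw [map_mul, hP, map_X, mul_assoc]⟩

theorem exists_mem_toFibre_eq_C_mul {p : PrimeSpectrum A}
    {f : MvPolynomial (Fin n) p.asIdeal.ResidueField} (hf : f ∈ fibreIdeal I p) :
    ∃ P ∈ I, ∃ s : A, s ∉ p.asIdeal ∧ toFibre p P = C (algebraMap A _ s) * f := by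
  refine Submodule.span_induction ?_ ?_ ?_ ?_ hf
  · rintro _ ⟨P, hP, rfl⟩
    exact ⟨P, hP, 1, p.asIdeal.primeCompl.one_mem, by simp⟩
  · exact ⟨0, I.zero_mem, 1, p.asIdeal.primeCompl.one_mem, by simp⟩
  · rintro f g - - ⟨P, hPI, s, hs, hP⟩ ⟨Q, hQI, t, ht, hQ⟩
    refine ⟨C t * P + C s * Q, I.add_mem (I.mul_mem_left _ hPI) (I.mul_mem_left _ hQI), s * t,
      p.asIdeal.primeCompl.mul_mem hs ht, ?_⟩
    simp only [map_add, map_mul, map_C, hP, hQ]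
    ring
  · rintro g f - ⟨P, hPI, s, hs, hP⟩
    obtain ⟨Q, t, ht, hQ⟩ := exists_toFibre_eq_C_mul p g
    refine ⟨Q * P, I.mul_mem_left _ hPI, t * s, p.asIdeal.primeCompl.mul_mem ht hs, ?_⟩
    simp only [map_mul, hP, hQ, smul_eq_mul]
    ring

theorem algebraMap_residueField_ne_zero {p : PrimeSpectrum A} {s : A} (hs : s ∉ p.asIdeal) :
    algebraMap A p.asIdeal.ResidueField s ≠ 0 :=
  fun h => hs (algebraMap_residueField_eq_zero_iff.mp h)

/-- A polynomial over `A` whose coefficients above `t` vanish at `q` and whose coefficient at `t`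
does not has leading term `t` over `k(q)`. -/
theorem degree_toFibre_eq {q : PrimeSpectrum A} {P : MvPolynomial (Fin n) A} {t : Fin n →₀ ℕ}
    (ht : coeff t P ∉ q.asIdeal) (h : ∀ u, m.toSyn t < m.toSyn u → coeff u P ∈ q.asIdeal) :
    toFibre q P ≠ 0 ∧ m.degree (toFibre q P) = t := by
  have hc : coeff t (toFibre q P) ≠ 0 := by rw [coeff_map]; exact algebraMap_residueField_ne_zero ht
  have h0 : toFibre q P ≠ 0 := fun h => hc (by rw [h, coeff_zero])
  refine ⟨h0, m.toSyn.injective (le_antisymm (le_of_not_gt fun hlt => ?_)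
    (m.le_degree (mem_support_iff.mpr hc)))⟩
  refine m.coeff_degree_ne_zero_iff.mpr h0 ?_
  rw [coeff_map]
  exact algebraMap_residueField_eq_zero_iff.mpr (h _ hlt)

/-- Near `p`, the leading terms at `p` stay leading terms on the closure of `p`. -/
theorem exists_isOpen_fibreTerms_subset (p : PrimeSpectrum A) :
    ∃ U : Set (PrimeSpectrum A), IsOpen U ∧ p ∈ U ∧
      ∀ q ∈ U, p ≤ q → fibreTerms m I p ⊆ fibreTerms m I q := by
  set S := {t | Minimal (· ∈ fibreTerms m I p) t}
  have key : ∀ t : S, ∃ s, s ∉ p.asIdeal ∧ ∀ q : PrimeSpectrum A, s ∉ q.asIdeal → p ≤ q →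
      t.1 ∈ fibreTerms m I q := by
    rintro ⟨t, ht⟩
    obtain ⟨f, hf⟩ := exists_isNormalElement ht.1
    obtain ⟨P, hP, s, hs, hPs⟩ := exists_mem_toFibre_eq_C_mul hf.1
    have hcoeff (u) : algebraMap A p.asIdeal.ResidueField (coeff u P) =
        algebraMap A _ s * coeff u f := by
      rw [← coeff_C_mul, ← hPs, coeff_map]
    have hct : coeff t P ∉ p.asIdeal := by
      rw [← algebraMap_residueField_eq_zero_iff, hcoeff, hf.2 t ht.1, if_pos rfl, mul_one]
      exact algebraMap_residueField_ne_zero hs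
    refine ⟨coeff t P, hct, fun q hq hpq => ?_⟩
    -- The coefficients of `P` above `t` vanish at `p`, hence at every `q` in its closure. Only the
    -- coefficient at `t` imposes an open condition.
    have := degree_toFibre_eq (m := m) hq fun u hu => hpq (by
      rw [← algebraMap_residueField_eq_zero_iff, hcoeff,
        m.coeff_eq_zero_of_lt (by rwa [hf.degree_eq ht.1]), mul_zero])
    exact ⟨_, toFibre_mem hP q, this⟩
  choose s hs hsq using key
  have : Finite S := finite_minimal_terms _
  refine ⟨⋂ t : S, (PrimeSpectrum.basicOpen (s t) : Set (PrimeSpectrum A)),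
    isOpen_iInter_of_finite fun t => (PrimeSpectrum.basicOpen (s t)).2,
    Set.mem_iInter.mpr fun t => hs t, fun q hq hpq u hu => ?_⟩
  obtain ⟨t, htu, ht⟩ := exists_minimal_term_le hu
  exact ltSet_isUpperSet htu (hsq ⟨t, ht⟩ q (Set.mem_iInter.mp hq ⟨t, ht⟩) hpq)

/-- An element of the fibre ideal that comes from a homogeneous element of `I` is determined by its
coefficients at the leading terms of its degree. -/
theorem toFibre_eq_zero_of_coeff {d : ℕ} {q : PrimeSpectrum A} {P : MvPolynomial (Fin n) A}
    (hPI : P ∈ I) (hP : P.IsHomogeneous d)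
    (h : ∀ u ∈ fibreTermsOfDegree m I d q, coeff u P ∈ q.asIdeal) : toFibre q P = 0 := by
  refine eq_zero_of_coeff_ltSet (m := m) (toFibre_mem hPI q) fun u hu => ?_
  rw [coeff_map, algebraMap_residueField_eq_zero_iff]
  by_cases hd : u.degree = d
  · exact h u ⟨hu, hd⟩
  · rw [hP.coeff_eq_zero hd]; exact zero_mem _

theorem isNormalElement_toFibre {d : ℕ} {q : PrimeSpectrum A} {D : A} (hD : D ∉ q.asIdeal)
    {t : Fin n →₀ ℕ} (ht : t ∈ fibreTermsOfDegree m I d q) {Q : MvPolynomial (Fin n) A}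
    (hQI : Q ∈ I) (hQ : Q.IsHomogeneous d)
    (h : ∀ u ∈ fibreTermsOfDegree m I d q, coeff u Q = if u = t then D else 0) :
    IsNormalElement m (fibreIdeal I q) t (C (algebraMap A _ D)⁻¹ * toFibre q Q) := by
  refine ⟨Ideal.mul_mem_left _ _ (toFibre_mem hQI q), fun u hu => ?_⟩
  rw [coeff_C_mul, coeff_map]
  by_cases hd : u.degree = d
  · rw [h u ⟨hu, hd⟩]
    split_ifs
    · exact inv_mul_cancel₀ (algebraMap_residueField_ne_zero hD)
    · simp
  · rw [hQ.coeff_eq_zero hd, if_neg fun hut : u = t => hd (hut ▸ ht.2), map_zero, mul_zero]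

/-! ### Homogeneous ideals: Cramer lifts and variation of the leading terms -/

variable (hI : I.IsHomogeneous (homogeneousSubmodule (Fin n) A))

include hI

theorem exists_isHomogeneous_toFibre_eq_C_mul {p : PrimeSpectrum A} (d : ℕ)
    {f : MvPolynomial (Fin n) p.asIdeal.ResidueField} (hf : f ∈ fibreIdeal I p) :
    ∃ P ∈ I, P.IsHomogeneous d ∧ ∃ s : A, s ∉ p.asIdeal ∧
      toFibre p P = C (algebraMap A _ s) * homogeneousComponent d f := by
  obtain ⟨P, hP, s, hs, h⟩ := exists_mem_toFibre_eq_C_mul hf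
  exact ⟨_, homogeneousComponent_mem_of_mem hI hP d, homogeneousComponent_isHomogeneous d P, s, hs,
    by rw [toFibre, map_homogeneousComponent, h, homogeneousComponent_C_mul]⟩

/-- The normal elements of degree `d` at `p` lift to elements of `I` with the same coefficients at
the leading terms, up to a common factor. -/
theorem exists_lift_normal (p : PrimeSpectrum A) (d : ℕ) :
    ∃ D : A, D ∉ p.asIdeal ∧ ∀ t ∈ fibreTermsOfDegree m I d p, ∃ Q ∈ I, Q.IsHomogeneous d ∧
      ∀ u ∈ fibreTermsOfDegree m I d p, coeff u Q = if u = t then D else 0 := by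
  classical
  set S := fibreTermsOfDegree m I d p
  have : Fintype S := (finite_fibreTermsOfDegree d p).fintype
  have key : ∀ t : S, ∃ P ∈ I, P.IsHomogeneous d ∧ ∃ s : A, s ∉ p.asIdeal ∧
      ∀ u : S, algebraMap A p.asIdeal.ResidueField (coeff u.1 P) =
        if t = u then algebraMap A _ s else 0 := by
    rintro ⟨t, ht⟩
    obtain ⟨f, hf⟩ := exists_isNormalElement ht.1
    obtain ⟨P, hPI, hP, s, hs, h⟩ := exists_isHomogeneous_toFibre_eq_C_mul hI d hf.1
    refine ⟨P, hPI, hP, s, hs, fun u => ?_⟩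
    rw [← coeff_map, h, coeff_C_mul, coeff_homogeneousComponent, if_pos u.2.2, hf.2 _ u.2.1]
    by_cases htu : u.1 = t
    · rw [if_pos htu, if_pos (Subtype.ext htu.symm), mul_one]
    · rw [if_neg htu, if_neg fun e => htu (by rw [← e]), mul_zero]
  choose P hPI hP s hs hcoeff using key
  -- At `p` this matrix is diagonal with nonzero entries, but over `A` it need not be diagonal.
  -- Combining the rows by the adjugate makes it `det M` times the identity over `A` itself.
  set M : Matrix S S A := Matrix.of fun t u => coeff u.1 (P t) with hM
  refine ⟨M.det, ?_, fun t ht => ?_⟩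
  · rw [← algebraMap_residueField_eq_zero_iff, RingHom.map_det]
    have : (algebraMap A p.asIdeal.ResidueField).mapMatrix M =
        Matrix.diagonal fun t => algebraMap A _ (s t) := by
      ext t u
      rw [RingHom.mapMatrix_apply, Matrix.map_apply, hM, Matrix.of_apply, hcoeff,
        Matrix.diagonal_apply]
    rw [this, Matrix.det_diagonal]
    exact Finset.prod_ne_zero_iff.mpr fun t _ => algebraMap_residueField_ne_zero (hs t)
  · refine ⟨∑ v : S, C (M.adjugate ⟨t, ht⟩ v) * P v,
      I.sum_mem fun v _ => I.mul_mem_left _ (hPI v), ?_, fun u hu => ?_⟩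
    · refine IsHomogeneous.sum _ _ _ fun v _ => ?_
      simpa using (isHomogeneous_C (Fin n) (M.adjugate ⟨t, ht⟩ v)).mul (hP v)
    · have := congrFun (congrFun M.adjugate_mul ⟨t, ht⟩) ⟨u, hu⟩
      rw [Matrix.mul_apply, Matrix.smul_apply, Matrix.one_apply, smul_eq_mul, mul_ite, mul_one,
        mul_zero] at this
      rw [coeff_sum]
      simp only [coeff_C_mul]
      refine this.trans ?_
      simp only [Subtype.mk.injEq, eq_comm]

/-- The number of leading terms of degree `d` does not grow under specialization. -/
theorem ncard_fibreTermsOfDegree_le {p q : PrimeSpectrum A} (hpq : p ≤ q) (d : ℕ) :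
    (fibreTermsOfDegree m I d q).ncard ≤ (fibreTermsOfDegree m I d p).ncard := by
  classical
  obtain ⟨D, hD, key⟩ := exists_lift_normal (m := m) hI q d
  have hDp : D ∉ p.asIdeal := fun h => hD (hpq h)
  have key' : ∀ t : fibreTermsOfDegree m I d q, ∃ Q ∈ I, Q.IsHomogeneous d ∧
      ∀ u ∈ fibreTermsOfDegree m I d q, coeff u Q = if u = t.1 then D else 0 := fun t => key t t.2
  choose Q hQI hQ hcoeff using key'
  have : Fintype (fibreTermsOfDegree m I d p) := (finite_fibreTermsOfDegree d p).fintype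
  have : Fintype (fibreTermsOfDegree m I d q) := (finite_fibreTermsOfDegree d q).fintype
  set K := p.asIdeal.ResidueField
  -- Sends `v` to the coefficients at `T_d(p)` of `∑ v_u Q_u` over `k(p)`. If these vanish, so does
  -- the combination, and reading it at `T_d(q)` gives `D v = 0`, where `D` is nonzero at `p` too.
  let φ : (fibreTermsOfDegree m I d q → K) →ₗ[K] (fibreTermsOfDegree m I d p → K) :=
    Matrix.mulVecLin (Matrix.of fun w u => coeff w.1 (toFibre p (Q u)))
  have hφ : Function.Injective φ := by
    rw [injective_iff_map_eq_zero]
    intro v hv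
    have hF : ∑ u, C (v u) * toFibre p (Q u) = 0 := by
      refine eq_zero_of_coeff_ltSet (m := m) ((fibreIdeal I p).sum_mem fun u _ =>
        (fibreIdeal I p).mul_mem_left _ (toFibre_mem (hQI u) p)) fun w hw => ?_
      rw [coeff_sum]
      by_cases hd : w.degree = d
      · refine Eq.trans ?_ (congrFun hv ⟨w, hw, hd⟩)
        exact Finset.sum_congr rfl fun u _ => by rw [coeff_C_mul]; exact mul_comm _ _
      · exact Finset.sum_eq_zero fun u _ => by
          rw [coeff_C_mul, coeff_map, (hQ u).coeff_eq_zero hd, map_zero, mul_zero]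
    funext w
    have := congrArg (coeff w.1) hF
    rw [coeff_sum, Finset.sum_eq_single w, coeff_C_mul, coeff_map, hcoeff w _ w.2, if_pos rfl,
      coeff_zero] at this
    · exact (mul_eq_zero.mp this).resolve_right (algebraMap_residueField_ne_zero hDp)
    · intro u _ hu
      rw [coeff_C_mul, coeff_map, hcoeff u _ w.2, if_neg fun h => hu (Subtype.ext h.symm), map_zero,
        mul_zero]
    · simp
  have := LinearMap.finrank_le_finrank_of_injective hφ
  rwa [Module.finrank_fintype_fun_eq_card, Module.finrank_fintype_fun_eq_card,
    ← Nat.card_eq_fintype_card, ← Nat.card_eq_fintype_card] at this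

/-- `lt(⟨σ_q(I)⟩)` is constant on a nonempty open subset of the closure of `p`. -/
theorem exists_isOpen_fibreTerms_eq (p : PrimeSpectrum A) :
    ∃ U : Set (PrimeSpectrum A), IsOpen U ∧ p ∈ U ∧
      ∀ q ∈ U, p ≤ q → fibreTerms m I q = fibreTerms m I p := by
  obtain ⟨U, hU, hpU, h⟩ := exists_isOpen_fibreTerms_subset (m := m) (I := I) p
  refine ⟨U, hU, hpU, fun q hq hpq => ?_⟩
  have hd (d) : fibreTermsOfDegree m I d p = fibreTermsOfDegree m I d q :=
    Set.eq_of_subset_of_ncard_le (fun t ht => ⟨h q hq hpq ht.1, ht.2⟩)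
      (ncard_fibreTermsOfDegree_le hI hpq d) (finite_fibreTermsOfDegree d q)
  refine Set.Subset.antisymm (fun t ht => ?_) (h q hq hpq)
  have : t ∈ fibreTermsOfDegree m I t.degree q := ⟨ht, rfl⟩
  rw [← hd] at this
  exact this.1

/-- Wherever `D` is invertible on the class of `p`, the lifts `Q_t` divided by `D` are the normal
elements. Polynomial identities among coefficients valid there pass to the closure wherever `D ≠ 0`,
which pins down the leading terms at such limit points. -/
theorem fibreTermsOfDegree_eq_of_mem_closure (p : PrimeSpectrum A) (d : ℕ) :
    ∃ D : A, D ∉ p.asIdeal ∧ ∀ q : PrimeSpectrum A, D ∉ q.asIdeal →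
      q ∈ closure {q | fibreTermsOfDegree m I d q = fibreTermsOfDegree m I d p} →
      fibreTermsOfDegree m I d q = fibreTermsOfDegree m I d p := by
  classical
  obtain ⟨D, hD, key⟩ := exists_lift_normal (m := m) hI p d
  have key' : ∀ t : fibreTermsOfDegree m I d p, ∃ Q ∈ I, Q.IsHomogeneous d ∧
      ∀ u ∈ fibreTermsOfDegree m I d p, coeff u Q = if u = t.1 then D else 0 := fun t => key t t.2
  choose Q hQI hQ hcoeff using key'
  have : Fintype (fibreTermsOfDegree m I d p) := (finite_fibreTermsOfDegree d p).fintype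
  refine ⟨D, hD, fun q hDq hq => ?_⟩
  have hmem : ∀ a : A, (∀ q' : PrimeSpectrum A, D ∉ q'.asIdeal →
      fibreTermsOfDegree m I d q' = fibreTermsOfDegree m I d p → a ∈ q'.asIdeal) →
      a ∈ q.asIdeal := by
    intro a ha
    rw [← PrimeSpectrum.zeroLocus_vanishingIdeal_eq_closure] at hq
    -- Nothing is known about `a` at class points where `D` vanishes; the factor `D` covers those.
    have : D * a ∈ q.asIdeal := hq ((PrimeSpectrum.mem_vanishingIdeal _ _).mpr fun q' hq' => by
      by_cases hDq' : D ∈ q'.asIdeal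
      · exact Ideal.mul_mem_right _ _ hDq'
      · exact Ideal.mul_mem_left _ _ (ha q' hDq' hq'))
    exact (q.isPrime.mem_or_mem this).resolve_left hDq
  have hQq (t : fibreTermsOfDegree m I d p) :
      toFibre q (Q t) ≠ 0 ∧ m.degree (toFibre q (Q t)) = t.1 := by
    refine degree_toFibre_eq (by rw [hcoeff t t t.2, if_pos rfl]; exact hDq) fun u hu =>
      hmem _ fun q' hDq' hq' => ?_
    have ht : t.1 ∈ fibreTermsOfDegree m I d q' := hq'.ge t.2
    have hN := isNormalElement_toFibre hDq' ht (hQI t) (hQ t) 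
      fun u hu => hcoeff t u (hq'.le hu)
    have := m.coeff_eq_zero_of_lt (by rwa [hN.degree_eq ht.1])
    rw [coeff_C_mul, coeff_map] at this
    exact algebraMap_residueField_eq_zero_iff.mp
      ((mul_eq_zero.mp this).resolve_left (inv_ne_zero (algebraMap_residueField_ne_zero hDq')))
  apply Set.Subset.antisymm
  · rintro t ⟨ht, htd⟩
    obtain ⟨f, hf⟩ := exists_isNormalElement ht
    obtain ⟨P, hPI, hP, s, hs, hPf⟩ := exists_isHomogeneous_toFibre_eq_C_mul hI d hf.1
    have hPle (u) (hu : coeff u P ∉ q.asIdeal) : m.toSyn u ≤ m.toSyn t := by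
      rw [← algebraMap_residueField_eq_zero_iff, ← coeff_map, hPf, coeff_C_mul,
        coeff_homogeneousComponent] at hu
      rw [← hf.degree_eq ht]
      refine m.le_degree (mem_support_iff.mpr fun h => hu ?_)
      simp [h]
    have hPt : coeff t P ∉ q.asIdeal := by
      rw [← algebraMap_residueField_eq_zero_iff, ← coeff_map, hPf, coeff_C_mul,
        coeff_homogeneousComponent, if_pos htd, hf.2 t ht, if_pos rfl, mul_one]
      exact algebraMap_residueField_ne_zero hs
    -- `R` has no coefficients at `T_d(p)`, so it vanishes on the class where `D ≠ 0`, and its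
    -- coefficient at `t` vanishes at `q`. Thus at `q` the nonzero `D P` and `∑ c_u(P) Q_u` agree at
    -- `t`: some `u` in `T_d(p)` occurs in `P` while `t` occurs in `Q_u`. Hence `u ≤ t ≤ u` in the
    -- term order.
    set R := C D * P - ∑ u, C (coeff u.1 P) * Q u with hR
    have hRI : R ∈ I :=
      I.sub_mem (I.mul_mem_left _ hPI) (I.sum_mem fun u _ => I.mul_mem_left _ (hQI u))
    have hRd : R.IsHomogeneous d := by
      refine IsHomogeneous.sub ?_ (IsHomogeneous.sum _ _ _ fun v _ => ?_)
      · simpa using (isHomogeneous_C (Fin n) D).mul hP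
      · simpa using (isHomogeneous_C (Fin n) (coeff v.1 P)).mul (hQ v)
    have hRcoeff (w) : coeff w R = D * coeff w P - ∑ u, coeff u.1 P * coeff w (Q u) := by
      simp [hR, coeff_sum]
    have hRp (w) (hw : w ∈ fibreTermsOfDegree m I d p) : coeff w R = 0 := by
      rw [hRcoeff, Finset.sum_eq_single ⟨w, hw⟩, hcoeff _ w hw, if_pos rfl, mul_comm, sub_self]
      · intro u _ hu
        rw [hcoeff _ w hw, if_neg fun h => hu (Subtype.ext h.symm), mul_zero]
      · simp
    have hRt : coeff t R ∈ q.asIdeal := hmem _ fun q' hDq' hq' => by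
      rw [← algebraMap_residueField_eq_zero_iff, ← coeff_map,
        toFibre_eq_zero_of_coeff (m := m) hRI hRd fun u hu => by
          rw [hRp u (hq'.le hu)]; exact zero_mem _, coeff_zero]
    have hsum : ∑ u, coeff u.1 P * coeff t (Q u) ∉ q.asIdeal := fun h => by
      have := q.asIdeal.add_mem hRt h
      rw [hRcoeff, sub_add_cancel] at this
      exact (q.isPrime.mem_or_mem this).elim hDq hPt
    obtain ⟨u, -, hu⟩ : ∃ u ∈ Finset.univ, coeff u.1 P * coeff t (Q u) ∉ q.asIdeal := by
      by_contra! h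
      exact hsum (q.asIdeal.sum_mem h)
    have h1 := hPle u fun h => hu (Ideal.mul_mem_right _ _ h)
    have h2 : m.toSyn t ≤ m.toSyn u := by
      rw [← (hQq u).2]
      refine m.le_degree (mem_support_iff.mpr fun h => hu (Ideal.mul_mem_left _ _ ?_))
      rwa [coeff_map, algebraMap_residueField_eq_zero_iff] at h
    have : t = u.1 := m.toSyn.injective (le_antisymm h2 h1)
    exact this ▸ u.2
  · intro t ht
    exact ⟨⟨_, toFibre_mem (hQI ⟨t, ht⟩) q, hQq ⟨t, ht⟩⟩, ht.2⟩

end Fibres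

/-! ### Finiteness and local closedness of the equivalence classes -/

section Classes

/-- Noetherian induction on closed sets: a reducible set is a union of two smaller ones; an
irreducible one has a generic point `p`, and outside the open set where `f = f p` a smaller closed
set remains. -/
theorem finite_range_of_generically_constant {A β : Type*} [CommRing A] [IsNoetherianRing A]
    (f : PrimeSpectrum A → β) (h : ∀ p, ∃ U : Set (PrimeSpectrum A), IsOpen U ∧ p ∈ U ∧
      ∀ q ∈ U, p ≤ q → f q = f p) : (Set.range f).Finite := by
  suffices H : ∀ Z : TopologicalSpace.Closeds (PrimeSpectrum A), (f '' Z).Finite by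
    simpa using H ⊤
  intro Z
  induction Z using WellFoundedLT.induction with
  | ind Z ih =>
    obtain hZ | hne := (Z : Set (PrimeSpectrum A)).eq_empty_or_nonempty
    · simp [hZ]
    by_cases hirr : IsPreirreducible (Z : Set (PrimeSpectrum A))
    · obtain ⟨p, hp⟩ := QuasiSober.sober ⟨hne, hirr⟩ Z.isClosed
      obtain ⟨U, hU, hpU, hconst⟩ := h p
      let W : TopologicalSpace.Closeds (PrimeSpectrum A) :=
        ⟨Z ∩ Uᶜ, Z.isClosed.inter hU.isClosed_compl⟩
      have hW : W < Z := SetLike.coe_ssubset_coe.mp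
        ⟨Set.inter_subset_left, fun hsub => (hsub hp.mem).2 hpU⟩
      refine ((ih W hW).insert (f p)).subset ?_
      rintro _ ⟨q, hq, rfl⟩
      by_cases hqU : q ∈ U
      · refine Or.inl (hconst q hqU ?_)
        rw [PrimeSpectrum.le_iff_mem_closure, hp.def]
        exact hq
      · exact Or.inr ⟨q, ⟨hq, hqU⟩, rfl⟩
    · rw [isPreirreducible_iff_isClosed_union_isClosed] at hirr
      push Not at hirr
      obtain ⟨Z₁, Z₂, h₁, h₂, hsub, hn₁, hn₂⟩ := hirr
      have hlt (V : Set (PrimeSpectrum A)) (hV : IsClosed V)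
          (hn : ¬ (Z : Set (PrimeSpectrum A)) ⊆ V) : (f '' (Z ∩ V)).Finite :=
        ih ⟨Z ∩ V, Z.isClosed.inter hV⟩ (SetLike.coe_ssubset_coe.mp
          ⟨Set.inter_subset_left, fun hs => hn fun x hx => (hs hx).2⟩)
      refine ((hlt Z₁ h₁ hn₁).union (hlt Z₂ h₂ hn₂)).subset ?_
      rintro _ ⟨q, hq, rfl⟩
      exact (hsub hq).imp (fun h => ⟨q, ⟨hq, h⟩, rfl⟩) fun h => ⟨q, ⟨hq, h⟩, rfl⟩

theorem isLocallyClosed_biInter {X ι : Type*} [TopologicalSpace X] {s : Set ι} (hs : s.Finite)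
    {f : ι → Set X} (h : ∀ i ∈ s, IsLocallyClosed (f i)) : IsLocallyClosed (⋂ i ∈ s, f i) := by
  induction s, hs using Set.Finite.induction_on with
  | empty => simpa using isOpen_univ.isLocallyClosed
  | insert _ _ ih =>
    rw [Set.biInter_insert]
    exact (h _ (Set.mem_insert _ _)).inter (ih fun i hi => h i (Set.mem_insert_of_mem _ hi))

variable {n : ℕ} {A : Type*} [CommRing A] {m : MonomialOrder (Fin n)}
  {I : Ideal (MvPolynomial (Fin n) A)} (hI : I.IsHomogeneous (homogeneousSubmodule (Fin n) A))

include hI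

theorem isLocallyClosed_fibreTermsOfDegree_eq (d : ℕ) (S : Set (Fin n →₀ ℕ)) :
    IsLocallyClosed {q | fibreTermsOfDegree m I d q = S} := by
  -- Criterion used: each point of the set has a neighbourhood in which the closure of the set stays
  -- inside the set.
  refine ((isLocallyClosed_tfae _).out 0 3).mpr ?_
  rintro p rfl
  obtain ⟨D, hD, h⟩ := fibreTermsOfDegree_eq_of_mem_closure (m := m) hI p d
  exact ⟨PrimeSpectrum.basicOpen D, hD, (PrimeSpectrum.basicOpen D).2, fun q hq => h q hq.1 hq.2⟩

variable [IsNoetherianRing A]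

theorem finite_range_fibreTerms : (Set.range (fibreTerms m I)).Finite :=
  finite_range_of_generically_constant _ (exists_isOpen_fibreTerms_eq hI)

theorem isLocallyClosed_fibreTerms_eq (T : Set (Fin n →₀ ℕ)) :
    IsLocallyClosed {q | fibreTerms m I q = T} := by
  -- One degree separating `T'` from `T`, arbitrary if they coincide. As only finitely many `T'`
  -- occur, equality with `T` is a finite intersection of one-degree conditions.
  have hd : ∀ T' : Set (Fin n →₀ ℕ), ∃ d : ℕ, T' ≠ T →
      {t | t ∈ T' ∧ t.degree = d} ≠ {t | t ∈ T ∧ t.degree = d} := by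
    intro T'
    by_contra! h
    have hne := (h 0).1
    refine hne (Set.ext fun t => ?_)
    simpa using Set.ext_iff.mp (h t.degree).2 t
  choose d hd using hd
  have : {q | fibreTerms m I q = T} = ⋂ T' ∈ Set.range (fibreTerms m I),
      {q | fibreTermsOfDegree m I (d T') q = {t | t ∈ T ∧ t.degree = d T'}} := by
    ext q
    simp only [Set.mem_iInter]
    constructor
    · rintro rfl _ -
      rfl
    · intro h
      by_contra hq
      exact hd _ hq (h _ ⟨q, rfl⟩)
  rw [this]
  exact isLocallyClosed_biInter (finite_range_fibreTerms hI) fun T' _ =>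
    isLocallyClosed_fibreTermsOfDegree_eq hI _ _

theorem finite_ltClasses (L : Set (PrimeSpectrum A)) : (ltClasses m I L).Finite := by
  refine ((finite_range_fibreTerms (m := m) hI).image fun T =>
    {q | q ∈ L ∧ T = fibreTerms m I q}).subset ?_
  rintro Y ⟨p, hp, rfl⟩
  exact ⟨_, ⟨p, rfl⟩, rfl⟩

theorem isLocallyClosed_of_mem_ltClasses {L : Set (PrimeSpectrum A)} (hL : IsLocallyClosed L)
    {Y : Set (PrimeSpectrum A)} (hY : Y ∈ ltClasses m I L) : IsLocallyClosed Y := by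
  obtain ⟨p, hp, rfl⟩ := hY
  convert hL.inter (isLocallyClosed_fibreTerms_eq hI (fibreTerms m I p)) using 1
  ext q
  exact and_congr_right fun _ => eq_comm

end Classes

/-! ### Sections and their specializations -/

section Sections

variable {n : ℕ} {A : Type*} [CommRing A] {m : MonomialOrder (Fin n)}
  {I : Ideal (MvPolynomial (Fin n) A)} {Y : Set (PrimeSpectrum A)}

theorem smul_stalkToFibre_mk (p : Y) (P : extModule I Y) (s : p.1.asIdeal.primeCompl) :
    s.1 • stalkToFibre I p (LocalizedModule.mk P s) = extModuleToFibre I p P := by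
  rw [← map_smul, LocalizedModule.smul'_mk]
  change stalkToFibre I p (LocalizedModule.mk (s • P) s) = _
  rw [LocalizedModule.mk_cancel]
  exact LinearMap.congr_fun (LocalizedModule.lift_comp _ (extModuleToFibre I p)
    (isUnit_algebraMap_end p.1)) P

theorem coeff_extModuleToFibre (p : Y) (P : extModule I Y) (u : Fin n →₀ ℕ) :
    coeff u (extModuleToFibre I p P) = toResidue p (coeff u P.1) :=
  coeff_map _ _ _

/-- An element of `(A/a)[x]` that vanishes at all points of `Y` is zero. -/
theorem eq_zero_of_extModuleToFibre {P : extModule I Y}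
    (h : ∀ p : Y, extModuleToFibre I p P = 0) : P = 0 := by
  refine Subtype.ext (MvPolynomial.ext _ _ fun u => ?_)
  obtain ⟨a, ha⟩ := Ideal.Quotient.mk_surjective (coeff u P.1)
  rw [ZeroMemClass.coe_zero, coeff_zero, ← ha, Ideal.Quotient.eq_zero_iff_mem,
    PrimeSpectrum.mem_vanishingIdeal]
  intro p hp
  have := coeff_extModuleToFibre ⟨p, hp⟩ P u
  rw [h, coeff_zero, ← ha] at this
  exact Ideal.algebraMap_residueField_eq_zero.mp this.symm

/-- Fractions that agree in the fibres over `Y` where they are defined agree in the stalks. -/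
theorem localizedModule_mk_eq {P P' : extModule I Y} {s s' : A} {q : Y}
    (hs : s ∈ q.1.asIdeal.primeCompl) (hs' : s' ∈ q.1.asIdeal.primeCompl) {r : A}
    (hr : r ∈ q.1.asIdeal.primeCompl)
    (h : ∀ (p : Y) (hs : s ∈ p.1.asIdeal.primeCompl) (hs' : s' ∈ p.1.asIdeal.primeCompl),
      r ∈ p.1.asIdeal.primeCompl → stalkToFibre I p (LocalizedModule.mk P ⟨s, hs⟩) =
        stalkToFibre I p (LocalizedModule.mk P' ⟨s', hs'⟩)) :
    (LocalizedModule.mk P ⟨s, hs⟩ : Stalk I Y q.1) = LocalizedModule.mk P' ⟨s', hs'⟩ := by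
  rw [LocalizedModule.mk_eq]
  -- At points where `r s s'` vanishes it kills the difference; at all others both fractions are
  -- defined and agree by hypothesis. So the multiplied difference vanishes in every fibre over `Y`.
  refine ⟨⟨r * s * s', mul_mem (mul_mem hr hs) hs'⟩, ?_⟩
  change (r * s * s') • s' • P = (r * s * s') • s • P'
  rw [← sub_eq_zero]
  refine eq_zero_of_extModuleToFibre fun p => ?_
  rw [map_sub, map_smul, map_smul, map_smul, map_smul, ← smul_sub]
  by_cases hp : r * s * s' ∈ p.1.asIdeal
  · refine MvPolynomial.ext _ _ fun u => ?_
    rw [coeff_smul, Algebra.smul_def, algebraMap_residueField_eq_zero_iff.mpr hp, zero_mul,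
      coeff_zero]
  · have hs'p : s' ∈ p.1.asIdeal.primeCompl := fun h => hp (Ideal.mul_mem_left _ _ h)
    have hrs : r * s ∉ p.1.asIdeal := fun h => hp (Ideal.mul_mem_right _ _ h)
    have hsp : s ∈ p.1.asIdeal.primeCompl := fun h => hrs (Ideal.mul_mem_left _ _ h)
    have hrp : r ∈ p.1.asIdeal.primeCompl := fun h => hrs (Ideal.mul_mem_right _ _ h)
    rw [← smul_stalkToFibre_mk p P ⟨s, hsp⟩, ← smul_stalkToFibre_mk p P' ⟨s', hs'p⟩,
      h p hsp hs'p hrp, smul_comm, sub_self, smul_zero]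

/-- A section is determined by its specializations. -/
theorem sections_ext {g h : Sections I Y} (H : ∀ p : Y, specialize p g = specialize p h) :
    g = h := by
  refine Subtype.ext (funext fun q => ?_)
  obtain ⟨U, hU, hqU, P, s, hP⟩ := g.2 q
  obtain ⟨V, hV, hqV, Q, t, hQ⟩ := h.2 q
  obtain ⟨W, hW, hWUV⟩ := isOpen_induced_iff.mp (hU.inter hV)
  obtain ⟨_, ⟨r, rfl⟩, hqr, hrW⟩ :=
    PrimeSpectrum.isTopologicalBasis_basic_opens.exists_subset_of_mem_open
      (show q.1 ∈ W from hWUV.ge ⟨hqU, hqV⟩) hW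
  obtain ⟨hsq, hgq⟩ := hP q hqU
  obtain ⟨htq, hhq⟩ := hQ q hqV
  rw [hgq, hhq]
  refine localizedModule_mk_eq hsq htq (r := r) hqr fun p hsp htp hrp => ?_
  have hp : p ∈ U ∩ V := hWUV.le (hrW hrp)
  obtain ⟨_, hgp⟩ := hP p hp.1
  obtain ⟨_, hhp⟩ := hQ p hp.2
  rw [← hgp, ← hhp]
  exact H p

variable (Y) in
/-- The image of an element of `I` in `(A/a)[x]`. -/
def toExtModule {P : MvPolynomial (Fin n) A} (hP : P ∈ I) : extModule I Y :=
  ⟨MvPolynomial.map (Ideal.Quotient.mk (PrimeSpectrum.vanishingIdeal Y)) P,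
    Ideal.mem_map_of_mem _ hP⟩

theorem extModuleToFibre_toExtModule (p : Y) {P : MvPolynomial (Fin n) A} (hP : P ∈ I) :
    extModuleToFibre I p (toExtModule Y hP) = toFibre p.1 P := by
  refine MvPolynomial.ext _ _ fun u => ?_
  rw [coeff_extModuleToFibre, toExtModule, coeff_map, coeff_map]
  rfl

variable (hI : I.IsHomogeneous (homogeneousSubmodule (Fin n) A))

include hI

/-- If `lt(⟨σ_p(I)⟩)` is constant on `Y`, the normal elements of a leading term `t` are the
specializations of a section. -/
theorem exists_section_isNormalElement {T : Set (Fin n →₀ ℕ)}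
    (hY : ∀ p ∈ Y, fibreTerms m I p = T) {t : Fin n →₀ ℕ} (ht : t ∈ T) :
    ∃ g : Sections I Y, ∀ p : Y, IsNormalElement m (fibreIdeal I p.1) t (specialize p g) := by
  have key : ∀ p : Y, ∃ D ∈ p.1.asIdeal.primeCompl, ∃ P : extModule I Y, ∀ (q : Y)
      (hq : D ∈ q.1.asIdeal.primeCompl), IsNormalElement m (fibreIdeal I q.1) t
        (stalkToFibre I q (LocalizedModule.mk P ⟨D, hq⟩)) := by
    intro p
    obtain ⟨D, hD, h⟩ := exists_lift_normal (m := m) hI p.1 t.degree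
    obtain ⟨Q, hQI, hQ, hcoeff⟩ := h t ⟨(hY p p.2).ge ht, rfl⟩
    refine ⟨D, hD, toExtModule Y hQI, fun q hq => ?_⟩
    have hqp : fibreTermsOfDegree m I t.degree q.1 = fibreTermsOfDegree m I t.degree p.1 := by
      simp only [fibreTermsOfDegree, hY p p.2, hY q q.2]
    have hN := isNormalElement_toFibre hq ⟨(hY q q.2).ge ht, rfl⟩ hQI hQ
      fun u hu => hcoeff u (hqp.le hu)
    convert hN using 1
    rw [← extModuleToFibre_toExtModule q hQI, ← smul_stalkToFibre_mk q _ ⟨D, hq⟩, ← algebraMap_smul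
      q.1.asIdeal.ResidueField, smul_eq_C_mul, ← mul_assoc, ← C_mul,
      inv_mul_cancel₀ (algebraMap_residueField_ne_zero hq), C_1, one_mul]
  choose D hD P hP using key
  refine ⟨⟨fun p => LocalizedModule.mk (P p) ⟨D p, hD p⟩, fun p =>
    ⟨{q | D p ∉ q.1.asIdeal}, (PrimeSpectrum.basicOpen (D p)).2.preimage continuous_subtype_val,
      hD p, P p, D p, fun q hq => ⟨hq, ?_⟩⟩⟩, fun p => hP p p (hD p)⟩
  -- Gluing: wherever two of the local fractions are both defined, they specialize to normal
  -- elements of the same term, which coincide.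
  exact localizedModule_mk_eq (r := 1) (hD q) hq (one_mem _) fun q' h h' _ =>
    (hP q q' h).unique (hP p q' h')

end Sections

/-! ### The canonical Groebner cover -/

section Canonical

variable {n : ℕ} {A : Type*} [CommRing A] {m : MonomialOrder (Fin n)}
  {I : Ideal (MvPolynomial (Fin n) A)} {Y : Set (PrimeSpectrum A)}

theorem exists_isReducedGroebnerBasisOver
    (hI : I.IsHomogeneous (homogeneousSubmodule (Fin n) A)) {T : Set (Fin n →₀ ℕ)}
    (hY : ∀ p ∈ Y, fibreTerms m I p = T) :
    ∃ G : Set (Sections I Y), IsReducedGroebnerBasisOver m I Y G := by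
  have key : ∀ t : {t | Minimal (· ∈ T) t}, ∃ g : Sections I Y,
      ∀ p : Y, IsNormalElement m (fibreIdeal I p.1) t (specialize p g) := fun t =>
    exists_section_isNormalElement hI hY t.2.1
  choose g hg using key
  have : Finite {t | Minimal (· ∈ T) t} := finite_minimal_terms T
  refine ⟨Set.range g, Set.finite_range g, fun p => ?_, ?_⟩
  · have hT : ltSet m (fibreIdeal I p.1 : Set (MvPolynomial (Fin n) p.1.asIdeal.ResidueField)) =
      T := hY p p.2
    rw [isReducedGroebnerBasis_iff, hT]
    ext f
    constructor
    · rintro ⟨_, ⟨t, rfl⟩, rfl⟩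
      exact ⟨t, t.2, hg t p⟩
    · rintro ⟨t, ht, hf⟩
      exact ⟨_, ⟨⟨t, ht⟩, rfl⟩, (hg ⟨t, ht⟩ p).unique hf⟩
  · rintro _ ⟨t, rfl⟩ p q
    rw [(hg t p).degree_eq ((hY p p.2).ge t.2.1), (hg t q).degree_eq ((hY q q.2).ge t.2.1)]

/-- Elements of `G` and `G'` matched at one point have the same leading term there, hence
everywhere, so they specialize to the same normal elements. Nonemptiness is essential: over the
empty set both `∅` and the singleton of the only section qualify. -/
theorem IsReducedGroebnerBasisOver.subset (hne : Y.Nonempty) {G G' : Set (Sections I Y)}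
    (hG : IsReducedGroebnerBasisOver m I Y G) (hG' : IsReducedGroebnerBasisOver m I Y G') :
    G ⊆ G' := by
  intro g hg
  obtain ⟨p, hp⟩ := hne
  have hnormal : ∀ {H : Set (Sections I Y)}, IsReducedGroebnerBasisOver m I Y H → ∀ h ∈ H,
      ∀ q : Y, m.degree (specialize q h) ∈ fibreTerms m I q.1 ∧
        IsNormalElement m (fibreIdeal I q.1) (m.degree (specialize q h)) (specialize q h) := by
    intro H hH h hh q
    obtain ⟨t, ht, hn⟩ := (isReducedGroebnerBasis_iff.mp (hH.2.1 q)).le ⟨h, hh, rfl⟩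
    rw [hn.degree_eq ht.1]
    exact ⟨ht.1, hn⟩
  obtain ⟨g', hg', he⟩ : specialize ⟨p, hp⟩ g ∈ specialize ⟨p, hp⟩ '' G' := by
    rw [isReducedGroebnerBasis_iff.mp (hG'.2.1 ⟨p, hp⟩),
      ← isReducedGroebnerBasis_iff.mp (hG.2.1 ⟨p, hp⟩)]
    exact ⟨g, hg, rfl⟩
  have : g = g' := sections_ext fun q => by
    have h1 := (hnormal hG g hg q).2
    rw [hG.2.2 g hg q ⟨p, hp⟩, ← he, hG'.2.2 g' hg' ⟨p, hp⟩ q] at h1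
    exact h1.unique (hnormal hG' g' hg' q).2
  rwa [this]

theorem nonempty_of_mem_ltClasses {L : Set (PrimeSpectrum A)} (hY : Y ∈ ltClasses m I L) :
    Y.Nonempty := by
  obtain ⟨p, hp, rfl⟩ := hY
  exact ⟨p, hp, rfl⟩

theorem fibreTerms_eq_of_mem_ltClasses {L : Set (PrimeSpectrum A)} (hY : Y ∈ ltClasses m I L) :
    ∃ T, ∀ p ∈ Y, fibreTerms m I p = T := by
  obtain ⟨p, hp, rfl⟩ := hY
  exact ⟨fibreTerms m I p, fun q hq => hq.2.symm⟩

theorem sUnion_ltClasses (L : Set (PrimeSpectrum A)) : ⋃₀ ltClasses m I L = L := by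
  refine Set.Subset.antisymm (Set.sUnion_subset ?_) fun p hp => ⟨_, ⟨p, hp, rfl⟩, hp, rfl⟩
  rintro _ ⟨p, hp, rfl⟩ q hq
  exact hq.1

end Canonical

end

end GroebnerCover

theorem mainTheorem5 {n : ℕ} {A : Type*} [CommRing A] [IsNoetherianRing A] [IsReduced A]
    (m : MonomialOrder (Fin n)) (I : Ideal (MvPolynomial (Fin n) A))
    (hI : I.IsHomogeneous (MvPolynomial.homogeneousSubmodule (Fin n) A))
    (L : Set (PrimeSpectrum A)) (hL : IsLocallyClosed L) :
    (∀ Y ∈ GroebnerCover.ltClasses m I L, GroebnerCover.IsParametric m I Y) ∧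
    ∃! 𝒢 : Set ((Y : Set (PrimeSpectrum A)) × Set (GroebnerCover.Sections I Y)),
      GroebnerCover.IsGroebnerCover m I L 𝒢 ∧
        Sigma.fst '' 𝒢 = GroebnerCover.ltClasses m I L := by
  have hpar : ∀ Y ∈ GroebnerCover.ltClasses m I L, GroebnerCover.IsParametric m I Y := by
    intro Y hY
    obtain ⟨T, hT⟩ := GroebnerCover.fibreTerms_eq_of_mem_ltClasses hY
    exact ⟨GroebnerCover.isLocallyClosed_of_mem_ltClasses hI hL hY,
      GroebnerCover.exists_isReducedGroebnerBasisOver hI hT⟩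
  -- Uniqueness: classes are nonempty, so the first component of a pair determines the second.
  have hsub : ∀ 𝒢 ℋ : Set ((Y : Set (PrimeSpectrum A)) × Set (GroebnerCover.Sections I Y)),
      GroebnerCover.IsGroebnerCover m I L 𝒢 → GroebnerCover.IsGroebnerCover m I L ℋ →
      Sigma.fst '' 𝒢 = GroebnerCover.ltClasses m I L →
      Sigma.fst '' ℋ = GroebnerCover.ltClasses m I L → 𝒢 ⊆ ℋ := by
    rintro 𝒢 ℋ h𝒢 hℋ h𝒢L hℋL ⟨Y, G⟩ hz
    have hY : Y ∈ GroebnerCover.ltClasses m I L := h𝒢L.le ⟨_, hz, rfl⟩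
    obtain ⟨⟨Y', H⟩, hw, rfl⟩ := hℋL.ge hY
    have hne := GroebnerCover.nonempty_of_mem_ltClasses hY
    have hG := (h𝒢.2.1 _ hz).2
    have hH := (hℋ.2.1 _ hw).2
    have hGH : G = H := (hG.subset hne hH).antisymm (hH.subset hne hG)
    rwa [hGH]
  refine ⟨hpar, ?_⟩
  have hbasis : ∀ Y : GroebnerCover.ltClasses m I L, ∃ G : Set (GroebnerCover.Sections I Y.1),
      GroebnerCover.IsReducedGroebnerBasisOver m I Y.1 G := fun Y => (hpar Y Y.2).2
  choose G hG using hbasis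
  have hfin : Finite (GroebnerCover.ltClasses m I L) := GroebnerCover.finite_ltClasses hI L
  have hfst : Sigma.fst '' (Set.range fun Y : GroebnerCover.ltClasses m I L =>
      (⟨Y.1, G Y⟩ : (Y : Set (PrimeSpectrum A)) × Set (GroebnerCover.Sections I Y))) =
      GroebnerCover.ltClasses m I L := by
    rw [← Set.range_comp]
    exact Subtype.range_coe
  have hcover : GroebnerCover.IsGroebnerCover m I L (Set.range fun Y :
      GroebnerCover.ltClasses m I L => ⟨Y.1, G Y⟩) := by
    refine ⟨Set.finite_range _, ?_, ?_⟩
    · rintro _ ⟨Y, rfl⟩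
      exact ⟨hpar Y Y.2, hG Y⟩
    · rw [← Set.sUnion_image, hfst, GroebnerCover.sUnion_ltClasses]
  exact ⟨_, ⟨hcover, hfst⟩, fun ℋ hℋ => (hsub _ _ hℋ.1 hcover hℋ.2 hfst).antisymm
    (hsub _ _ hcover hℋ.1 hfst hℋ.2)⟩
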